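/- Let $\mathcal{G}$ be the group of polynomial automorphisms of the affine plane over $\mathbb{C}$, an automorphism being written as the pair $(F_1,F_2)\in\mathbb{C}[X,Y]^2$ of its components. For $n\in\mathbb{N}$ let $\mathcal{G}_{\le n}\subset\mathcal{G}$ be the set of automorphisms whose components both have degree at most $n$, equipped with the Zariski topology induced from the finite-dimensional vector space of pairs of polynomials of degree at most $n$. Give $\mathcal{G}$ its Zariski topology as an ind-variety: a subset $A\subset\mathcal{G}$ is closed if and only if $A\cap\mathcal{G}_{\le n}$ is closed in $\mathcal{G}_{\le n}$ for every $n$; write $\overline{A}$ for the closure of $A$. For $d\in\mathbb{N}$ define the subgroups $$H_d=\{(X,\,Y+aX^d)\mid a\in\mathbb{C}\},\qquad K_d=\{(X+aY^d,\,Y)\mid a\in\mathbb{C}\}$$ of $\mathcal{G}$, and let $\langle S,T\rangle$ denote the subgroup generated by $S\cup T$. **Theorem.** For every integer $d\ge 2$, $$K_d\subset\overline{\langle K_2,H_1\rangle}\qquad\text{and}\qquad H_d\subset\overline{\langle H_2,K_1\rangle}.$$ -/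

import Mathlib

open MvPolynomial

/-- The group of polynomial automorphisms of the affine plane over `ℂ`. The plane automorphism
`(F₁, F₂)` is represented by the `ℂ`-algebra automorphism of `ℂ[X, Y]` (with `X = X 0`, `Y = X 1`)
that sends `X` to `F₁` and `Y` to `F₂`. Multiplication is composition of algebra automorphisms,
i.e. composition of plane automorphisms in the reverse order; this affects neither inverses nor the
subgroup generated by a given set. -/
def PlaneAut : Type := MvPolynomial (Fin 2) ℂ ≃ₐ[ℂ] MvPolynomial (Fin 2) ℂ

namespace PlaneAut

noncomputable instance instGroup : Group PlaneAut :=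
  inferInstanceAs (Group (MvPolynomial (Fin 2) ℂ ≃ₐ[ℂ] MvPolynomial (Fin 2) ℂ))

/-- The component `F₁` (for `i = 0`) or `F₂` (for `i = 1`) of `F = (F₁, F₂)`. -/
noncomputable def comp (F : PlaneAut) (i : Fin 2) : MvPolynomial (Fin 2) ℂ :=
  AlgEquiv.toAlgHom (R := ℂ) F (X i)

/-- The family of all coefficients of the two components of `F`. -/
noncomputable def coeffs (F : PlaneAut) : Fin 2 × (Fin 2 →₀ ℕ) → ℂ :=
  fun k => (F.comp k.1).coeff k.2

/-- The piece `𝒢_{≤ n}` of the ind-variety filtration: automorphisms of degree at most `n`. -/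
def degreeLE (n : ℕ) : Set PlaneAut :=
  {F | ∀ i, (F.comp i).totalDegree ≤ n}

/-- `A` is relatively Zariski closed in `𝒢_{≤ n}`, regarded as a subset of the finite-dimensional
affine space of pairs of polynomials of degree at most `n`: on `𝒢_{≤ n}`, membership in `A` is
defined by polynomial equations in the coefficients. -/
def IsClosedInDegreeLE (n : ℕ) (A : Set PlaneAut) : Prop :=
  ∃ I : Ideal (MvPolynomial (Fin 2 × (Fin 2 →₀ ℕ)) ℂ),
    ∀ F ∈ degreeLE n, F ∈ A ↔ F.coeffs ∈ zeroLocus ℂ I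

/-- The Zariski topology of the ind-variety `𝒢 = ⋃ₙ 𝒢_{≤ n}`: a set is closed iff its intersection
with every `𝒢_{≤ n}` is Zariski closed in `𝒢_{≤ n}`. -/
instance instTopologicalSpace : TopologicalSpace PlaneAut :=
  TopologicalSpace.ofClosed {A | ∀ n, IsClosedInDegreeLE n A}
    (fun _ => ⟨⊤, fun F _ => by
      simp only [Set.mem_empty_iff_false, mem_zeroLocus_iff, false_iff, not_forall]
      exact ⟨1, trivial, by simp⟩⟩)
    (fun S hS n => by
      choose I hI using fun A : S => hS A.2 n
      refine ⟨⨆ A, I A, fun F hF => ?_⟩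
      simp only [Set.mem_sInter, mem_zeroLocus_iff]
      constructor
      · intro h
        have hle : (⨆ A, I A) ≤ RingHom.ker (aeval (R := ℂ) F.coeffs) :=
          iSup_le fun A p hp => (hI A F hF).1 (h A A.2) p hp
        exact fun p hp => hle hp
      · exact fun h A hA => (hI ⟨A, hA⟩ F hF).2 fun p hp => h p (le_iSup I ⟨A, hA⟩ hp))
    (fun A hA B hB n => by
      obtain ⟨I, hI⟩ := hA n
      obtain ⟨J, hJ⟩ := hB n
      refine ⟨I ⊓ J, fun F hF => ?_⟩
      rw [Set.mem_union, hI F hF, hJ F hF]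
      simp only [mem_zeroLocus_iff]
      constructor
      · rintro (h | h) p hp
        · exact h p hp.1
        · exact h p hp.2
      · intro h
        by_contra! hc
        obtain ⟨⟨p, hp, hp0⟩, q, hq, hq0⟩ := hc
        have := h (p * q) ⟨I.mul_mem_right q hp, J.mul_mem_left p hq⟩
        rw [map_mul] at this
        exact (mul_ne_zero hp0 hq0) this)

theorem isClosed_iff (A : Set PlaneAut) : IsClosed A ↔ ∀ n, IsClosedInDegreeLE n A := by
  rw [← isOpen_compl_iff]
  change Aᶜᶜ ∈ {A | ∀ n, IsClosedInDegreeLE n A} ↔ _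
  rw [compl_compl]
  exact Iff.rfl

/-- The automorphism `(X + a Y ^ d, Y)`. -/
noncomputable def shearX (d : ℕ) (a : ℂ) : PlaneAut :=
  AlgEquiv.ofAlgHom (aeval ![X 0 + C a * X 1 ^ d, X 1]) (aeval ![X 0 - C a * X 1 ^ d, X 1])
    (by ext i; fin_cases i <;> simp [algebraMap_eq])
    (by ext i; fin_cases i <;> simp [algebraMap_eq])

/-- The automorphism `(X, Y + a X ^ d)`. -/
noncomputable def shearY (d : ℕ) (a : ℂ) : PlaneAut :=
  AlgEquiv.ofAlgHom (aeval ![X 0, X 1 + C a * X 0 ^ d]) (aeval ![X 0, X 1 - C a * X 0 ^ d])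
    (by ext i; fin_cases i <;> simp [algebraMap_eq])
    (by ext i; fin_cases i <;> simp [algebraMap_eq])

/-- `K_d = {(X + a Y ^ d, Y) ∣ a ∈ ℂ}`. -/
noncomputable def K (d : ℕ) : Set PlaneAut := Set.range (shearX d)

/-- `H_d = {(X, Y + a X ^ d) ∣ a ∈ ℂ}`. -/
noncomputable def H (d : ℕ) : Set PlaneAut := Set.range (shearY d)

end PlaneAut

namespace PlaneAut

/-! Conjugating `(X, Y + s² X)` by the shear `(X + s⁻¹ p(Y), Y)` gives a family whose poles at `s =
0` cancel; by Taylor expansion its limit is `(X - p'(Y) p(Y), Y)` (`shear_mem_of_family`). The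
closure of a subgroup is closed under products, so the limits can be polarized: if all multiples of
`p` and `q` give shears in the closure, so do those of `(p q)'`. With `p = Y^d` and `q = Y²` this
passes from `Y^d` to `Y^(d+1)`, and induction gives the claim for `K_d`. Conjugation by `(Y, X)`
gives the one for `H_d`. -/

theorem toAlgHom_eq_aeval (F : PlaneAut) :
    AlgEquiv.toAlgHom (R := ℂ) F = aeval F.comp :=
  aeval_unique _

theorem comp_mul (F G : PlaneAut) (i : Fin 2) :
    (F * G).comp i = aeval F.comp (G.comp i) := by
  rw [← toAlgHom_eq_aeval]
  rfl

theorem ext_comp {F G : PlaneAut} (h : ∀ i, F.comp i = G.comp i) : F = G := by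
  have h' : AlgEquiv.toAlgHom (R := ℂ) F = AlgEquiv.toAlgHom (R := ℂ) G :=
    algHom_ext h
  exact AlgEquiv.ext fun p => DFunLike.congr_fun h' p

theorem coeffs_apply (F : PlaneAut) (k : Fin 2 × (Fin 2 →₀ ℕ)) :
    F.coeffs k = (F.comp k.1).coeff k.2 := rfl

/-! ### Continuity of translations -/

theorem totalDegree_mapAlgHom_le {R S : Type*} [CommSemiring R] [CommSemiring S] [Algebra ℂ R]
    [Algebra ℂ S] (f : R →ₐ[ℂ] S) (p : MvPolynomial (Fin 2) R) :
    (mapAlgHom f p).totalDegree ≤ p.totalDegree := by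
  rw [mapAlgHom_apply]
  exact Finset.sup_mono (support_map_subset (f : R →+* S) p)

/-- The generic polynomials in two variables of degree at most `n`, with indeterminate
coefficients. -/
noncomputable def generic (n : ℕ) (i : Fin 2) :
    MvPolynomial (Fin 2) (MvPolynomial (Fin 2 × (Fin 2 →₀ ℕ)) ℂ) :=
  ∑ m ∈ (Finset.range (n + 1)).biUnion (Finset.univ.finsuppAntidiag ·),
    monomial m (X (i, m))

theorem map_generic {n : ℕ} {F : PlaneAut} (hF : F ∈ degreeLE n) (i : Fin 2) :
    mapAlgHom (aeval (R := ℂ) F.coeffs) (generic n i) = F.comp i := by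
  have hsub : (F.comp i).support ⊆
      (Finset.range (n + 1)).biUnion (Finset.univ.finsuppAntidiag ·) := by
    intro m hm
    have h := (le_totalDegree hm).trans (hF i)
    simp only [Finset.mem_biUnion, Finset.mem_range, Finset.mem_finsuppAntidiag]
    refine ⟨_, Nat.lt_succ_of_le h, ?_, Finset.subset_univ _⟩
    rw [Finsupp.sum_fintype _ _ (by simp)]
  conv_rhs => rw [(F.comp i).as_sum]
  rw [generic, map_sum, Finset.sum_subset hsub]
  · simp [coeffs_apply]
  · intro m _ hm
    rw [notMem_support_iff.1 hm, monomial_zero]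

/-- A self-map of the plane automorphisms is continuous as soon as, on each `𝒢_{≤ n}`, it is given
by polynomials with coefficients polynomial in the coefficients of the argument. -/
theorem continuous_of_polynomial (f : PlaneAut → PlaneAut)
    (Φ : ℕ → Fin 2 → MvPolynomial (Fin 2) (MvPolynomial (Fin 2 × (Fin 2 →₀ ℕ)) ℂ))
    (hΦ : ∀ n, ∀ F ∈ degreeLE n, ∀ i,
      (f F).comp i = mapAlgHom (aeval (R := ℂ) F.coeffs) (Φ n i)) :
    Continuous f := by
  refine continuous_iff_isClosed.2 fun A hA => (isClosed_iff _).2 fun n => ?_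
  obtain ⟨I, hI⟩ := (isClosed_iff A).1 hA (Finset.univ.sup fun i => (Φ n i).totalDegree)
  -- The comorphism of `f` on `𝒢_{≤ n}`: the preimage of the zero locus of `I` is cut out by `ψ(I)`.
  let ψ : MvPolynomial (Fin 2 × (Fin 2 →₀ ℕ)) ℂ →ₐ[ℂ] MvPolynomial (Fin 2 × (Fin 2 →₀ ℕ)) ℂ :=
    aeval fun k => (Φ n k.1).coeff k.2
  refine ⟨I.map ψ, fun F hF => ?_⟩
  have hdeg : f F ∈ degreeLE (Finset.univ.sup fun i => (Φ n i).totalDegree) := fun i => by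
    rw [hΦ n F hF i]
    exact (totalDegree_mapAlgHom_le _ _).trans
      (Finset.le_sup (f := fun i => (Φ n i).totalDegree) (Finset.mem_univ i))
  have hcomp : (aeval (R := ℂ) (f F).coeffs : _ →ₐ[ℂ] ℂ) = (aeval F.coeffs).comp ψ := by
    refine algHom_ext fun k => ?_
    simp [ψ, coeffs_apply, hΦ n F hF, coeff_map]
  rw [Set.mem_preimage, hI _ hdeg, mem_zeroLocus_iff, mem_zeroLocus_iff]
  change I ≤ RingHom.ker (aeval (R := ℂ) (f F).coeffs) ↔
    I.map ψ ≤ RingHom.ker (aeval (R := ℂ) F.coeffs)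
  rw [Ideal.map_le_iff_le_comap, hcomp]
  exact Iff.rfl

theorem continuous_mul_left' (G : PlaneAut) : Continuous (G * ·) := by
  refine continuous_of_polynomial _
    (fun n i => bind₁ (fun j => map C (G.comp j)) (generic n i)) fun n F hF i => ?_
  rw [comp_mul, ← map_generic hF]
  simp only [mapAlgHom_apply, map_bind₁, map_map]
  have : ((aeval F.coeffs : MvPolynomial (Fin 2 × (Fin 2 →₀ ℕ)) ℂ →ₐ[ℂ] ℂ) :
      MvPolynomial (Fin 2 × (Fin 2 →₀ ℕ)) ℂ →+* ℂ).comp C = RingHom.id ℂ := by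
    ext x
    simp
  simp only [this, map_id, aeval_eq_bind₁]

theorem continuous_mul_right' (G : PlaneAut) : Continuous (· * G) := by
  refine continuous_of_polynomial _
    (fun n i => aeval (R := ℂ) (generic n) (G.comp i)) fun n F hF i => ?_
  rw [comp_mul, ← AlgHom.comp_apply, comp_aeval]
  simp_rw [map_generic hF]

/-- Separate continuity suffices: left translations by elements of `S` preserve the closure, then
right translation by `G` maps `S`, hence its closure, into the closure. -/
theorem mul_mem_closure {S : Subgroup PlaneAut} {F G : PlaneAut}
    (hF : F ∈ closure (S : Set PlaneAut)) (hG : G ∈ closure (S : Set PlaneAut)) :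
    F * G ∈ closure (S : Set PlaneAut) := by
  have h : ∀ s ∈ S, s * G ∈ closure (S : Set PlaneAut) := fun s hs =>
    map_mem_closure (continuous_mul_left' s) hG fun _ hg => S.mul_mem hs hg
  rw [← closure_closure]
  exact map_mem_closure (f := (· * G)) (continuous_mul_right' G) hF h

/-! ### Limits of polynomial families -/

/-- Specialization of the parameter at `s`. -/
noncomputable def specialization (s : ℂ) :
    MvPolynomial (Fin 2) (Polynomial ℂ) →ₐ[ℂ] MvPolynomial (Fin 2) ℂ :=
  mapAlgHom (Polynomial.aeval s)

theorem specialization_X (s : ℂ) (i : Fin 2) : specialization s (X i) = X i := by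
  simp [specialization]

theorem specialization_C (s : ℂ) (q : Polynomial ℂ) : specialization s (C q) = C (q.eval s) := by
  simp [specialization]

theorem specialization_aeval (s : ℂ) (x : MvPolynomial (Fin 2) (Polynomial ℂ))
    (p : Polynomial ℂ) :
    specialization s (Polynomial.aeval x p) = Polynomial.aeval (specialization s x) p :=
  (Polynomial.aeval_algHom_apply _ _ _).symm

/-- A closed set that contains the members `s ≠ 0` of a family of plane automorphisms depending
polynomially on `s` contains the member `s = 0`. -/
theorem mem_of_polynomial_family {A : Set PlaneAut} (hA : IsClosed A)
    (Φ : Fin 2 → MvPolynomial (Fin 2) (Polynomial ℂ)) (F : PlaneAut)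
    (hF : ∀ i, F.comp i = specialization 0 (Φ i))
    (h : ∀ s : ℂ, s ≠ 0 → ∃ G ∈ A, ∀ i, G.comp i = specialization s (Φ i)) :
    F ∈ A := by
  obtain ⟨I, hI⟩ := (isClosed_iff A).1 hA (Finset.univ.sup fun i => (Φ i).totalDegree)
  have hdeg : ∀ (s : ℂ) (G : PlaneAut),
      (∀ i, G.comp i = specialization s (Φ i)) →
      G ∈ degreeLE (Finset.univ.sup fun i => (Φ i).totalDegree) := fun s G hG i => by
    rw [hG i]
    exact (totalDegree_mapAlgHom_le _ _).trans
      (Finset.le_sup (f := fun i => (Φ i).totalDegree) (Finset.mem_univ i))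
  have hcoeff : ∀ (s : ℂ) (G : PlaneAut),
      (∀ i, G.comp i = specialization s (Φ i)) →
      ∀ p, aeval (R := ℂ) G.coeffs p =
        (aeval (R := ℂ) (fun k : Fin 2 × (Fin 2 →₀ ℕ) => (Φ k.1).coeff k.2) p).eval s := by
    intro s G hG p
    have : (aeval (R := ℂ) G.coeffs : _ →ₐ[ℂ] ℂ) = (Polynomial.aeval s).comp
        (aeval (R := ℂ) (fun k : Fin 2 × (Fin 2 →₀ ℕ) => (Φ k.1).coeff k.2)) := by
      refine algHom_ext fun k => ?_
      simp [coeffs_apply, hG, specialization, coeff_map]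
    rw [this, AlgHom.comp_apply, Polynomial.coe_aeval_eq_eval]
  refine (hI F (hdeg 0 F hF)).2 ((mem_zeroLocus_iff).2 fun p hp => ?_)
  rw [hcoeff 0 F hF]
  -- Along the family an equation of `A` is a polynomial in `s` vanishing on the infinite set `s ≠
  -- 0`.
  have hz : aeval (R := ℂ) (fun k : Fin 2 × (Fin 2 →₀ ℕ) => (Φ k.1).coeff k.2) p = 0 := by
    refine Polynomial.eq_zero_of_infinite_isRoot _
      ((Set.finite_singleton (0 : ℂ)).infinite_compl.mono fun s hs => ?_)
    obtain ⟨G, hGA, hG⟩ := h s hs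
    have := (mem_zeroLocus_iff).1 ((hI G (hdeg s G hG)).1 hGA) p hp
    rwa [hcoeff s G hG] at this
  rw [hz, Polynomial.eval_zero]

/-! ### Shears and the induction on the degree -/

/-- The automorphism `(X + p(Y), Y)`. -/
noncomputable def shear (p : Polynomial ℂ) : PlaneAut :=
  AlgEquiv.ofAlgHom (aeval ![X 0 + Polynomial.aeval (X 1) p, X 1])
    (aeval ![X 0 - Polynomial.aeval (X 1) p, X 1])
    (by ext i; fin_cases i <;> simp [← Polynomial.aeval_algHom_apply])
    (by ext i; fin_cases i <;> simp [← Polynomial.aeval_algHom_apply])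

theorem shear_comp (p : Polynomial ℂ) :
    (shear p).comp = ![X 0 + Polynomial.aeval (X 1) p, X 1] := by
  funext i
  exact aeval_X _ i

theorem shearX_comp (d : ℕ) (a : ℂ) : (shearX d a).comp = ![X 0 + C a * X 1 ^ d, X 1] := by
  funext i
  exact aeval_X _ i

theorem shearY_comp (d : ℕ) (a : ℂ) : (shearY d a).comp = ![X 0, X 1 + C a * X 0 ^ d] := by
  funext i
  exact aeval_X _ i

theorem shear_C_mul_X_pow (d : ℕ) (a : ℂ) :
    shear (Polynomial.C a * Polynomial.X ^ d) = shearX d a := by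
  refine ext_comp fun i => ?_
  rw [shear_comp, shearX_comp]
  simp [algebraMap_eq]

theorem shear_add (p q : Polynomial ℂ) : shear (p + q) = shear p * shear q := by
  refine ext_comp fun i => ?_
  rw [comp_mul, shear_comp, shear_comp, shear_comp]
  fin_cases i <;> simp [← Polynomial.aeval_algHom_apply, add_assoc]

theorem exists_aeval_add {B : Type*} [CommRing B] [Algebra ℂ B] (p : Polynomial ℂ) (x y : B) :
    ∃ r : B, Polynomial.aeval (x + y) p =
      Polynomial.aeval x p + Polynomial.aeval x p.derivative * y + r * y ^ 2 := by
  obtain ⟨r, hr⟩ := (p.map (algebraMap ℂ B)).binomExpansion x y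
  rw [Polynomial.derivative_map] at hr
  simp only [Polynomial.eval_map_algebraMap] at hr
  exact ⟨r, hr⟩

/-- The limit of the family of composites of `(X + s⁻¹ p(Y), Y)`, `(X, Y + s² X)` and
`(X - s⁻¹ p(Y), Y)` as `s` tends to `0` is `(X - p'(Y) p(Y), Y)`. -/
theorem shear_mem_of_family {A : Set PlaneAut} (hA : IsClosed A) (p : Polynomial ℂ)
    (h : ∀ s : ℂ, s ≠ 0 →
      shear (s⁻¹ • p) * shearY 1 (s ^ 2) * shear (-(s⁻¹ • p)) ∈ A) :
    shear (-(p.derivative * p)) ∈ A := by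
  obtain ⟨t, ht⟩ : ∃ t : MvPolynomial (Fin 2) (Polynomial ℂ), t = C Polynomial.X := ⟨_, rfl⟩
  have hts : ∀ s, specialization s t = C s := fun s => by
    rw [ht, specialization_C, Polynomial.eval_X]
  -- The increment is `s² (X + s⁻¹ p(Y))` without its pole. It is divisible by `t`, so after
  -- division by `s` the remainder term still vanishes at `s = 0`.
  obtain ⟨r, hr⟩ := exists_aeval_add p (X 1) (t * (t * X 0 + Polynomial.aeval (X 1) p))
  refine mem_of_polynomial_family hA
    ![X 0 - Polynomial.aeval (X 1) p.derivative * (t * X 0 + Polynomial.aeval (X 1) p) -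
        t * r * (t * X 0 + Polynomial.aeval (X 1) p) ^ 2,
      X 1 + t * (t * X 0 + Polynomial.aeval (X 1) p)] _ ?_ ?_
  · intro i
    rw [shear_comp]
    fin_cases i <;> simp [hts, specialization_X, specialization_aeval, sub_eq_add_neg]
  · intro s hs
    refine ⟨_, h s hs, fun i => ?_⟩
    have hs' : (C s : MvPolynomial (Fin 2) ℂ) * C s⁻¹ = 1 := by
      rw [← C_mul, mul_inv_cancel₀ hs, C_1]
    have hr' := congrArg (specialization s) hr
    simp only [specialization_aeval, map_add, map_mul, map_pow, specialization_X, hts] at hr'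
    have h0 : (shear (s⁻¹ • p) * shearY 1 (s ^ 2)).comp 0 =
        X 0 + C s⁻¹ * Polynomial.aeval (X 1) p := by
      rw [comp_mul, shear_comp, shearY_comp]
      simp [smul_eq_C_mul]
    have h1 : (shear (s⁻¹ • p) * shearY 1 (s ^ 2)).comp 1 =
        X 1 + C s * (C s * X 0 + Polynomial.aeval (X 1) p) := by
      rw [comp_mul, shear_comp, shearY_comp]
      simp only [Matrix.cons_val_one, Matrix.cons_val_fin_one, map_add, map_mul, aeval_X,
        Matrix.cons_val_zero, map_smul, smul_eq_C_mul, pow_one, algHom_C, algebraMap_eq]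
      rw [C_pow]
      linear_combination C s * Polynomial.aeval (X 1) p * hs'
    rw [comp_mul, shear_comp (-(s⁻¹ • p))]
    fin_cases i
    · simp only [Fin.zero_eta, Matrix.cons_val_zero, map_add, map_neg, map_smul, aeval_X, h0,
        ← Polynomial.aeval_algHom_apply, h1]
      simp only [hr', smul_eq_C_mul, map_add, map_sub, map_mul, map_pow, specialization_X, hts,
        specialization_aeval]
      linear_combination (-(Polynomial.aeval (X 1) p.derivative *
          (C s * X 0 + Polynomial.aeval (X 1) p)) - C s * specialization s r *
          (C s * X 0 + Polynomial.aeval (X 1) p) ^ 2) * hs'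
    · simp [h1, hts, specialization_X, specialization_aeval]

theorem shear_derivative_mul_self_mem_closure {S : Subgroup PlaneAut}
    (hS : ∀ a, shearY 1 a ∈ closure (S : Set PlaneAut)) {p : Polynomial ℂ}
    (hp : ∀ c : ℂ, shear (c • p) ∈ closure (S : Set PlaneAut)) (c : ℂ) :
    shear (c • (p.derivative * p)) ∈ closure (S : Set PlaneAut) := by
  -- `p' p` is quadratic in `p`, so scaling `p` by a square root of `-c` produces the factor `c`.
  obtain ⟨b, hb⟩ := IsAlgClosed.exists_pow_nat_eq (-c) two_pos
  have h := shear_mem_of_family isClosed_closure (b • p) fun s _ =>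
    mul_mem_closure (mul_mem_closure (by rw [smul_smul]; exact hp _) (hS _))
      (by rw [smul_smul, ← neg_smul]; exact hp _)
  rwa [Polynomial.derivative_smul, smul_mul_smul_comm, ← pow_two, hb, neg_smul, neg_neg] at h

/-- Polarization: `(p q)' = (p + q)' (p + q) - p' p - q' q`. -/
theorem shear_derivative_mul_mem_closure {S : Subgroup PlaneAut}
    (hS : ∀ a, shearY 1 a ∈ closure (S : Set PlaneAut)) {p q : Polynomial ℂ}
    (hp : ∀ c : ℂ, shear (c • p) ∈ closure (S : Set PlaneAut))
    (hq : ∀ c : ℂ, shear (c • q) ∈ closure (S : Set PlaneAut)) (c : ℂ) :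
    shear (c • (p * q).derivative) ∈ closure (S : Set PlaneAut) := by
  have hpq : ∀ c : ℂ, shear (c • (p + q)) ∈ closure (S : Set PlaneAut) := fun c => by
    rw [smul_add, shear_add]
    exact mul_mem_closure (hp c) (hq c)
  have h : c • (p * q).derivative = c • ((p + q).derivative * (p + q)) +
      (-c) • (p.derivative * p) + (-c) • (q.derivative * q) := by
    rw [Polynomial.derivative_mul, Polynomial.derivative_add]
    simp only [Polynomial.smul_eq_C_mul, Polynomial.C_neg]
    ring
  rw [h, shear_add, shear_add]
  exact mul_mem_closure (mul_mem_closure (shear_derivative_mul_self_mem_closure hS hpq _)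
    (shear_derivative_mul_self_mem_closure hS hp _))
    (shear_derivative_mul_self_mem_closure hS hq _)

theorem K_subset_closure {d : ℕ} (hd : 2 ≤ d) :
    K d ⊆ closure ((Subgroup.closure (K 2 ∪ H 1) : Subgroup PlaneAut) : Set PlaneAut) := by
  have hH : ∀ a, shearY 1 a ∈
      closure ((Subgroup.closure (K 2 ∪ H 1) : Subgroup PlaneAut) : Set PlaneAut) := fun a =>
    subset_closure (Subgroup.subset_closure (Or.inr ⟨a, rfl⟩))
  have hK : ∀ a : ℂ, shear (a • Polynomial.X ^ 2) ∈
      closure ((Subgroup.closure (K 2 ∪ H 1) : Subgroup PlaneAut) : Set PlaneAut) := fun a => by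
    rw [Polynomial.smul_eq_C_mul, shear_C_mul_X_pow]
    exact subset_closure (Subgroup.subset_closure (Or.inl ⟨a, rfl⟩))
  have key : ∀ a : ℂ, shear (a • Polynomial.X ^ d) ∈
      closure ((Subgroup.closure (K 2 ∪ H 1) : Subgroup PlaneAut) : Set PlaneAut) := by
    induction d, hd using Nat.le_induction with
    | base => exact hK
    | succ d hd ih =>
      intro a
      have h := shear_derivative_mul_mem_closure hH ih hK (a / (d + 2 : ℕ))
      rwa [← pow_add, Polynomial.derivative_X_pow, ← Polynomial.smul_eq_C_mul, smul_smul,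
        div_mul_cancel₀ _ (Nat.cast_ne_zero.2 (by omega))] at h
  rintro _ ⟨a, rfl⟩
  rw [← shear_C_mul_X_pow, ← Polynomial.smul_eq_C_mul]
  exact key a

/-! ### Exchanging the coordinates -/

/-- The automorphism `(Y, X)`. -/
noncomputable def swap : PlaneAut := renameEquiv ℂ (Equiv.swap 0 1)

theorem swap_comp (i : Fin 2) : swap.comp i = X (Equiv.swap 0 1 i) :=
  rename_X _ i

theorem swap_mul_swap : swap * swap = 1 := by
  refine ext_comp fun i => ?_
  rw [comp_mul, swap_comp, aeval_X, swap_comp, Equiv.swap_apply_self]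
  rfl

theorem swap_mul_shearX (d : ℕ) (a : ℂ) : swap * shearX d a = shearY d a * swap := by
  refine ext_comp fun i => ?_
  rw [comp_mul, comp_mul, swap_comp, aeval_X, shearX_comp, shearY_comp]
  fin_cases i <;> simp [swap_comp, algebraMap_eq]

theorem conj_swap_shearX (d : ℕ) (a : ℂ) : swap * shearX d a * swap = shearY d a := by
  rw [swap_mul_shearX, mul_assoc, swap_mul_swap, mul_one]

theorem conj_swap_shearY (d : ℕ) (a : ℂ) : swap * shearY d a * swap = shearX d a := by
  rw [mul_assoc, ← swap_mul_shearX, ← mul_assoc, swap_mul_swap, one_mul]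

theorem swap_inv : swap⁻¹ = swap :=
  inv_eq_of_mul_eq_one_left swap_mul_swap

theorem conj_swap_mem {F : PlaneAut} (hF : F ∈ Subgroup.closure (K 2 ∪ H 1)) :
    swap * F * swap ∈ Subgroup.closure (H 2 ∪ K 1) := by
  have h : Subgroup.closure (K 2 ∪ H 1) ≤
      (Subgroup.closure (H 2 ∪ K 1)).comap (MulAut.conj swap).toMonoidHom := by
    rw [Subgroup.closure_le]
    rintro _ (⟨a, rfl⟩ | ⟨a, rfl⟩)
    · refine Subgroup.subset_closure (Or.inl ⟨a, ?_⟩)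
      simp [swap_inv, conj_swap_shearX]
    · refine Subgroup.subset_closure (Or.inr ⟨a, ?_⟩)
      simp [swap_inv, conj_swap_shearY]
  simpa [swap_inv] using h hF

theorem H_subset_closure {d : ℕ} (hd : 2 ≤ d) :
    H d ⊆ closure ((Subgroup.closure (H 2 ∪ K 1) : Subgroup PlaneAut) : Set PlaneAut) := by
  rintro _ ⟨a, rfl⟩
  rw [← conj_swap_shearX]
  exact map_mem_closure (f := fun F => swap * F * swap)
    ((continuous_mul_right' swap).comp (continuous_mul_left' swap))
    (K_subset_closure hd ⟨a, rfl⟩) fun _ hF => conj_swap_mem hF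

end PlaneAut

theorem mainTheorem8 (d : ℕ) (hd : 2 ≤ d) :
    PlaneAut.K d ⊆
        closure ((Subgroup.closure (PlaneAut.K 2 ∪ PlaneAut.H 1) : Subgroup PlaneAut) :
          Set PlaneAut) ∧
      PlaneAut.H d ⊆
        closure ((Subgroup.closure (PlaneAut.H 2 ∪ PlaneAut.K 1) : Subgroup PlaneAut) :
          Set PlaneAut) :=
  ⟨PlaneAut.K_subset_closure hd, PlaneAut.H_subset_closure hd⟩
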